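/- Let $\mathcal{P}_{fin}(\mathbb{N})$ be the collection of finite subsets of $\mathbb{N}$, identified with $\mathbb{N}$ through the computable bijection $Z\mapsto\sum_{i\in Z}2^i$; computability and arithmetical complexity on $\mathcal{P}_{fin}(\mathbb{N})$ are understood through this identification. For $\mathcal{S}\subseteq\mathcal{P}_{fin}(\mathbb{N})$ let $NU(\mathcal{S})$ be the set of all non-empty $T$ which are the union of finitely many elements of $\mathcal{S}$. Call $\mathcal{S}$ a $\Sigma_2$ set if there is a decidable relation $R$ with $\mathcal{S}=\{Z\mid\exists x\,\forall y\,R(x,y,Z)\}$, where $x,y$ range over $\mathbb{N}$. Theorem. There is a computable coloring $c:\mathcal{P}_{fin}(\mathbb{N})\to\{0,1\}$ such that for every $\Sigma_2$ set $\mathcal{S}\subseteq\mathcal{P}_{fin}(\mathbb{N})$ that contains infinitely many pairwise disjoint elements, $NU(\mathcal{S})$ is not monochromatic, i.e. $c$ is not constant on $NU(\mathcal{S})$. -/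

import Mathlib

namespace FiniteUnions

/-- `NU S`: the nonempty sets that are a union of finitely many elements of `S`. -/
def NU (S : Set (Finset ℕ)) : Set (Finset ℕ) :=
  {T | T.Nonempty ∧ ∃ F : Finset (Finset ℕ), (∀ A ∈ F, A ∈ S) ∧ T = F.biUnion id}

/-- `S` generates an IP set: it contains infinitely many pairwise disjoint elements. -/
def GeneratesIP (S : Set (Finset ℕ)) : Prop :=
  ∃ D : Set (Finset ℕ), D ⊆ S ∧ D.Infinite ∧ D.Pairwise Disjoint

/-- All elements of `A` have the same color under `c`. -/
def IsMonochromatic {κ : Type} (c : Finset ℕ → κ) (A : Set (Finset ℕ)) : Prop :=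
  ∃ i : κ, ∀ T ∈ A, c T = i

/-- The computable bijection `Finset.equivBitIndices` identifies `n = ∑ i ∈ Z, 2 ^ i` with the finite
set `Z`. A coloring of finite sets is computable if it is computable as a function of this code. -/
def IsComputableColoring {κ : Type} [Primcodable κ] (c : Finset ℕ → κ) : Prop :=
  Computable fun n : ℕ => c (Finset.equivBitIndices n)

/-- `S` is `Σ₂`: it has the form `{Z | ∃ x, ∀ y, R x y Z}` with `R` a decidable relation, finite
sets being given by their codes. -/
def IsSigmaTwo (S : Set (Finset ℕ)) : Prop :=
  ∃ R : ℕ → ℕ → Finset ℕ → Prop,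
    ComputablePred (fun t : ℕ × ℕ × ℕ => R t.1 t.2.1 (Finset.equivBitIndices t.2.2)) ∧
      ∀ Z : Finset ℕ, Z ∈ S ↔ ∃ x : ℕ, ∀ y : ℕ, R x y Z

end FiniteUnions

/-!
The color of a finite set `V` with largest element `s` is the parity of `|V ∩ Q s|`, for a set
`Q s` found by computable search. If `Z` lies below `s = max T` and `|Z ∩ Q s|` is odd, then `T` and
`T ∪ Z` get different colors. A set `S` with infinitely many pairwise disjoint elements has members
`T` lying entirely above any given bound. So it is enough that, for every such `Σ₂` set `S`, there is
a bound `b` such that for all large `s` some member of `S` below `b` meets `Q s` in an odd number of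
points.

Members of a `Σ₂` set can be guessed in the limit. The set with index `e` is
`{Z | ∃ x, ∀ y, R x y Z}` for the relation `R` decided by program `e`, and a set of pairs `(Z, x)` is discarded at the stage at which a `y`
refuting one of its pairs is found. At stage `s`, take for each `e < s` the least family (the one
with the least code, if there is one below `s`) of `2 ^ e` or more pairs, with distinct nonempty `Z`,
that has not yet been discarded. Since discarding is irrevocable, this guess settles, for infinite
`S`, on a family of true members (`exists_forall_ge_isFamily`).

The set `Q s` must meet, for each `e < s`, some `Z` in the current family for `e` in an odd number of
points. It exists whatever the guesses are, by linear algebra over `ZMod 2`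
(`exists_odd_card_inter`): the span of `e` vectors has fewer than `2 ^ e` nonzero elements, so a
member of the family for `e` can be chosen whose indicator vector is independent of those chosen
before, and some linear functional is then `1` on all the chosen vectors. All conditions on `Q s` are
primitive recursive, with `Nat.Partrec.Code.evaln` as the universal step-bounded evaluator, so `Q`
is computable by unbounded search.
-/

namespace FiniteUnions

open scoped Finset
open Primrec Nat.Partrec

/-! ### Odd intersections with large families -/

/-- From families `F e` of at least `2 ^ e` nonempty finite sets one can select members whose
indicator vectors over `ZMod 2` are linearly independent. -/
theorem exists_linearIndependent_indicator (F : ℕ → Finset (Finset ℕ)) (hF : ∀ e, 2 ^ e ≤ #(F e))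
    (h0 : ∀ e, ∅ ∉ F e) (n : ℕ) :
    ∃ z : Fin n → Finset ℕ, (∀ e : Fin n, z e ∈ F e) ∧
      LinearIndependent (ZMod 2) fun e => ∑ i ∈ z e, Finsupp.single i (1 : ZMod 2) := by
  classical
  set v : Finset ℕ → ℕ →₀ ZMod 2 := fun Z => ∑ i ∈ Z, Finsupp.single i 1 with hv
  have v_apply (Z : Finset ℕ) (j : ℕ) : v Z j = if j ∈ Z then 1 else 0 := by
    simp [hv, Finsupp.finsetSum_apply, Finsupp.single_apply]
  have v_inj : Function.Injective v := fun A B h => by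
    ext j
    have := DFunLike.congr_fun h j
    rw [v_apply, v_apply] at this
    by_cases hA : j ∈ A <;> by_cases hB : j ∈ B <;> simp_all
  induction n with
  | zero => exact ⟨Fin.elim0, fun e => e.elim0, linearIndependent_empty_type⟩
  | succ n ih =>
    obtain ⟨z, hz, hli⟩ := ih
    let W : Submodule (ZMod 2) (ℕ →₀ ZMod 2) := Submodule.span (ZMod 2) (Set.range fun e => v (z e))
    have : Module.Finite (ZMod 2) W := Module.Finite.span_of_finite _ (Set.finite_range _)
    have : Finite W := Module.finite_of_finite (ZMod 2)
    have hcard : (W : Set (ℕ →₀ ZMod 2)).ncard ≤ 2 ^ n := by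
      have := Module.natCard_eq_pow_finrank (K := ZMod 2) (V := W)
      rw [Nat.card_zmod] at this
      change Nat.card W ≤ _
      rw [this]
      refine Nat.pow_le_pow_right (by norm_num) ?_
      exact (finrank_range_le_card (R := ZMod 2) fun e => v (z e)).trans_eq (Fintype.card_fin n)
    -- At least `2 ^ n` nonzero indicators from `F n`, together with `0`, do not fit into the span.
    obtain ⟨A, hA, hAW⟩ : ∃ A ∈ F n, v A ∉ W := by
      by_contra! hall
      have hsub : (((insert ∅ (F n)).image v : Finset _) : Set (ℕ →₀ ZMod 2)) ⊆ W := by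
        intro w hw
        simp only [Finset.coe_image, Set.mem_image, Finset.mem_coe, Finset.mem_insert] at hw
        obtain ⟨B, rfl | hB, rfl⟩ := hw
        · simp [hv]
        · exact hall B hB
      have := Set.ncard_le_ncard hsub (Set.toFinite (W : Set (ℕ →₀ ZMod 2)))
      rw [Set.ncard_coe_finset, Finset.card_image_of_injective _ v_inj,
        Finset.card_insert_of_notMem (h0 n)] at this
      have := hF n
      omega
    refine ⟨Fin.snoc z A, fun e => ?_, ?_⟩
    · refine Fin.lastCases ?_ (fun i => ?_) e
      · simpa using hA
      · simpa using hz i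
    · have : (fun e => v ((Fin.snoc z A : Fin (n + 1) → Finset ℕ) e)) =
          Fin.snoc (fun e => v (z e)) (v A) := by
        ext1 e
        refine Fin.lastCases ?_ (fun i => ?_) e <;> simp
      change LinearIndependent _ (fun e => v ((Fin.snoc z A : Fin (n + 1) → Finset ℕ) e))
      rw [this]
      exact hli.finSnoc hAW

/-- Given families `F e` of at least `2 ^ e` nonempty finite sets, a single set `Q` meets some
member of each `F e` with `e < n` in an odd number of points. -/
theorem exists_odd_card_inter (F : ℕ → Finset (Finset ℕ)) (hF : ∀ e, 2 ^ e ≤ #(F e))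
    (h0 : ∀ e, ∅ ∉ F e) (n : ℕ) :
    ∃ Q : Finset ℕ, ∀ e < n, ∃ Z ∈ F e, Odd #(Q ∩ Z) := by
  classical
  obtain ⟨z, hz, hli⟩ := exists_linearIndependent_indicator F hF h0 n
  -- A linear functional with value `1` on every chosen indicator vector.
  obtain ⟨φ, hφ⟩ : ∃ φ : (ℕ →₀ ZMod 2) →ₗ[ZMod 2] ZMod 2,
      ∀ e, φ (∑ i ∈ z e, Finsupp.single i 1) = 1 := by
    obtain ⟨g, hg⟩ := LinearMap.exists_leftInverse_of_injective _ (LinearMap.ker_eq_bot.2 hli)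
    refine ⟨Finsupp.linearCombination (ZMod 2) (fun _ => (1 : ZMod 2)) ∘ₗ g, fun e => ?_⟩
    have := LinearMap.congr_fun hg (Finsupp.single e 1)
    simp only [LinearMap.comp_apply, Finsupp.linearCombination_single, one_smul,
      LinearMap.id_apply] at this
    rw [LinearMap.comp_apply, this]
    simp
  refine ⟨{i ∈ Finset.univ.biUnion z | φ (Finsupp.single i 1) = 1}, fun e he => ?_⟩
  refine ⟨z ⟨e, he⟩, hz ⟨e, he⟩, ?_⟩
  have h01 : ∀ a : ZMod 2, a = if a = 1 then 1 else 0 := by decide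
  rw [← ZMod.natCast_eq_one_iff_odd]
  calc ((#({i ∈ Finset.univ.biUnion z | φ (Finsupp.single i 1) = 1} ∩ z ⟨e, he⟩) : ℕ) : ZMod 2)
      = #{i ∈ z ⟨e, he⟩ | φ (Finsupp.single i 1) = 1} := by
        congr 2
        ext i
        simp only [Finset.mem_inter, Finset.mem_filter, Finset.mem_biUnion, Finset.mem_univ,
          true_and]
        exact ⟨fun h => ⟨h.2, h.1.2⟩, fun h => ⟨⟨⟨_, h.1⟩, h.2⟩, h.1⟩⟩
    _ = ∑ i ∈ z ⟨e, he⟩, φ (Finsupp.single i 1) := by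
        rw [← Finset.sum_boole]
        exact Finset.sum_congr rfl fun i _ => (h01 _).symm
    _ = 1 := by rw [← map_sum, hφ]

/-! ### Primitive recursion on codes of finite sets -/

theorem _root_.PrimrecRel.forall_lt_comp {α : Type*} [Primcodable α] {f : α → ℕ} {R : ℕ → α → Prop}
    (hf : Primrec f) (hR : PrimrecRel R) : PrimrecPred fun a => ∀ n < f a, R n a :=
  (hR.forall_mem_list.comp (Primrec.list_range.comp hf) Primrec.id).of_eq (by simp)

theorem _root_.PrimrecRel.exists_lt_comp {α : Type*} [Primcodable α] {f : α → ℕ} {R : ℕ → α → Prop}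
    (hf : Primrec f) (hR : PrimrecRel R) : PrimrecPred fun a => ∃ n < f a, R n a :=
  (hR.exists_mem_list.comp (Primrec.list_range.comp hf) Primrec.id).of_eq (by simp)

theorem _root_.PrimrecPred.imp {α : Type*} [Primcodable α] {p q : α → Prop} (hp : PrimrecPred p)
    (hq : PrimrecPred q) : PrimrecPred fun a => p a → q a := by
  classical exact (hp.not.or hq).of_eq fun _ => imp_iff_not_or.symm

theorem primrec_two_pow : Primrec fun i : ℕ => 2 ^ i :=
  (Primrec₂.unpaired'.1 Nat.Primrec.pow).comp (Primrec.const 2) Primrec.id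

/-- The finite set with code `n`. -/
abbrev bits (n : ℕ) : Finset ℕ := Finset.equivBitIndices n

theorem mem_bits {i n : ℕ} : i ∈ bits n ↔ n / 2 ^ i % 2 = 1 := by
  simp [bits, Nat.testBit_eq_decide_div_mod_eq]

theorem two_pow_le_of_mem_bits {i n : ℕ} (h : i ∈ bits n) : 2 ^ i ≤ n :=
  Nat.two_pow_le_of_mem_bitIndices (by simpa [bits] using h)

theorem lt_of_mem_bits {i n : ℕ} (h : i ∈ bits n) : i < n :=
  Nat.lt_two_pow_self.trans_le (two_pow_le_of_mem_bits h)

theorem primrecRel_mem_bits : PrimrecRel fun i n => i ∈ bits n :=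
  PrimrecPred.of_eq (Primrec.eq.comp (nat_mod.comp
    (nat_div.comp snd (primrec_two_pow.comp fst)) (Primrec.const 2)) (Primrec.const 1))
    fun _ => mem_bits.symm

theorem card_filter_bits (P : ℕ → Prop) [DecidablePred P] (n : ℕ) :
    #{i ∈ bits n | P i} = ((List.range n).filter fun i => i ∈ bits n ∧ P i).length := by
  rw [← List.toFinset_card_of_nodup (List.nodup_range.filter _)]
  congr 1
  ext i
  simp only [Finset.mem_filter, List.mem_toFinset, List.mem_filter, List.mem_range,
    decide_eq_true_eq]
  exact ⟨fun h => ⟨lt_of_mem_bits h.1, h⟩, fun h => h.2⟩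

theorem primrec_card_inter_bits : Primrec₂ fun m n => #(bits m ∩ bits n) := by
  have hR : PrimrecRel fun (i : ℕ) (a : ℕ × ℕ) => i ∈ bits a.1 ∧ i ∈ bits a.2 :=
    (primrecRel_mem_bits.comp fst (fst.comp snd)).and
      (primrecRel_mem_bits.comp fst (snd.comp snd))
  refine (list_length.comp (hR.listFilter.comp (list_range.comp fst) Primrec.id)).of_eq fun a => ?_
  change _ = #(bits a.1 ∩ bits a.2)
  rw [← Finset.filter_mem_eq_inter, card_filter_bits]
  rfl

theorem primrec_card_bits : Primrec fun n => #(bits n) :=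
  (primrec_card_inter_bits.comp Primrec.id Primrec.id).of_eq fun n => by simp

/-- `topBit n` is the largest element of the finite set with code `n`, and `0` for the empty set. -/
def topBit (n : ℕ) : ℕ := Nat.findGreatest (fun i => i ∈ bits n) n

theorem primrec_topBit : Primrec topBit := by
  refine nat_findGreatest Primrec.id ?_
  exact primrecRel_mem_bits.comp snd fst

theorem topBit_eq {n m : ℕ} (hm : m ∈ bits n) (hmax : ∀ i ∈ bits n, i ≤ m) : topBit n = m := by
  refine Nat.findGreatest_eq_iff.2 ⟨(lt_of_mem_bits hm).le, fun _ => hm, fun i hi _ h => ?_⟩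
  exact (hmax i h).not_gt hi

/-! ### Guessing families of members of a `Σ₂` set -/

/-- A number `p = Nat.pair z x` represents the finite set with code `z`, together with a proposed
witness `x` for its membership in the `Σ₂` set `{Z | ∃ x, ∀ y, R x y Z}`. It survives stage `s` if
the program with code `e`, which is meant to decide `R`, is not seen to reject `(x, y, z)` within
the evaluation bound `s` for any `y < s`. The value `0` encodes rejection; no answer is no
rejection, so that survival makes sense for every program. -/
def Survives (e p s : ℕ) : Prop :=
  ∀ y < s, Code.evaln s (Denumerable.ofNat Code e)
    (Nat.pair p.unpair.2 (Nat.pair y p.unpair.1)) ≠ some 0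

/-- `t` codes a set of at least `2 ^ e` pairs with distinct nonempty first components, all of which
survive stage `s`. The bounds `p < t` and `q < t` hold for all members of `bits t`; they make the
quantifiers visibly bounded. -/
def IsFamily (e t s : ℕ) : Prop :=
  2 ^ e ≤ #(bits t) ∧ ∀ p < t, p ∈ bits t → p.unpair.1 ≠ 0 ∧ Survives e p s ∧
    ∀ q < t, q ∈ bits t → q.unpair.1 = p.unpair.1 → q = p

/-- The finite set with code `m` is good at stage `s` if for each `e < s` for which some family
with code below `s` survives stage `s`, it meets a member of the least such family in an odd number
of points. -/
def IsGood (s m : ℕ) : Prop :=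
  ∀ e < s, ∀ t < s, IsFamily e t s → (∀ t' < t, ¬ IsFamily e t' s) →
    ∃ p < t, p ∈ bits t ∧ #(bits m ∩ bits p.unpair.1) % 2 = 1

theorem primrecPred_survives : PrimrecPred fun a : ℕ × ℕ × ℕ => Survives a.1 a.2.1 a.2.2 := by
  refine PrimrecRel.forall_lt_comp (snd.comp snd) (.not ?_)
  have hs : Primrec fun b : ℕ × ℕ × ℕ × ℕ => b.2.2.2 := snd.comp (snd.comp snd)
  have he : Primrec fun b : ℕ × ℕ × ℕ × ℕ => Denumerable.ofNat Code b.2.1 :=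
    (Primrec.ofNat Code).comp (fst.comp snd)
  have hp : Primrec fun b : ℕ × ℕ × ℕ × ℕ => b.2.2.1.unpair :=
    unpair.comp (fst.comp (snd.comp snd))
  exact Primrec.eq.comp (Code.primrec_evaln.comp ((hs.pair he).pair (Primrec₂.natPair.comp
    (snd.comp hp) (Primrec₂.natPair.comp fst (fst.comp hp))))) (Primrec.const (some 0))

theorem primrecPred_isFamily : PrimrecPred fun a : ℕ × ℕ × ℕ => IsFamily a.1 a.2.1 a.2.2 := by
  have ht : Primrec fun a : ℕ × ℕ × ℕ => a.2.1 := fst.comp snd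
  have hz : Primrec fun p : ℕ => p.unpair.1 := fst.comp unpair
  refine (nat_le.comp (primrec_two_pow.comp fst) (primrec_card_bits.comp ht)).and
    (PrimrecRel.forall_lt_comp ht (.imp ?_ (.and ?_ (.and ?_ (PrimrecRel.forall_lt_comp ?_
      (.imp ?_ (.imp ?_ ?_)))))))
  · exact primrecRel_mem_bits.comp fst (ht.comp snd)
  · exact (Primrec.eq.comp (hz.comp fst) (Primrec.const 0)).not
  · exact primrecPred_survives.comp ((fst.comp snd).pair (fst.pair (snd.comp (snd.comp snd))))
  · exact ht.comp snd
  · exact primrecRel_mem_bits.comp fst (ht.comp (snd.comp snd))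
  · exact Primrec.eq.comp (hz.comp fst) (hz.comp (fst.comp snd))
  · exact Primrec.eq.comp fst (fst.comp snd)

theorem primrecRel_isGood : PrimrecRel IsGood := by
  refine PrimrecRel.forall_lt_comp fst (PrimrecRel.forall_lt_comp (fst.comp snd)
    (.imp ?_ (.imp (PrimrecRel.forall_lt_comp fst (.not ?_)) (PrimrecRel.exists_lt_comp fst
      (.and ?_ ?_)))))
  · exact primrecPred_isFamily.comp ((fst.comp snd).pair (fst.pair (fst.comp (snd.comp snd))))
  · exact primrecPred_isFamily.comp ((fst.comp (snd.comp snd)).pair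
      (fst.pair (fst.comp (snd.comp (snd.comp snd)))))
  · exact primrecRel_mem_bits.comp fst (fst.comp snd)
  · exact Primrec.eq.comp (nat_mod.comp (primrec_card_inter_bits.comp
      (snd.comp (snd.comp (snd.comp snd))) (fst.comp (unpair.comp fst))) (Primrec.const 2))
      (Primrec.const 1)

/-! ### The coloring -/

/-- Good sets exist at every stage, by `exists_odd_card_inter`. The search for one therefore
terminates. -/
theorem exists_isGood (s : ℕ) : ∃ m, IsGood s m := by
  classical
  -- Indices without a surviving family get an arbitrary family of the required size.
  have hF : ∀ e, ∃ F : Finset (Finset ℕ), (2 ^ e ≤ #F ∧ ∅ ∉ F) ∧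
      ∀ t, IsFamily e t s → (∀ t' < t, ¬ IsFamily e t' s) →
        F = (bits t).image fun p => bits p.unpair.1 := by
    intro e
    by_cases h : ∃ t, IsFamily e t s
    · obtain ⟨hcard, hfam⟩ := Nat.find_spec h
      refine ⟨(bits (Nat.find h)).image fun p => bits p.unpair.1, ⟨?_, ?_⟩, fun t ht hmin => ?_⟩
      · rwa [Finset.card_image_of_injOn]
        intro p hp q hq hpq
        exact (hfam q (lt_of_mem_bits hq) hq).2.2 p (lt_of_mem_bits hp) hp
          (Finset.equivBitIndices.injective hpq)
      · simp only [Finset.mem_image, not_exists, not_and]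
        intro p hp h0
        refine (hfam p (lt_of_mem_bits hp) hp).1 (Finset.equivBitIndices.injective ?_)
        exact h0.trans (by simp)
      · rw [(Nat.find_eq_iff h).2 ⟨ht, hmin⟩]
    · refine ⟨(Finset.range (2 ^ e)).image fun i => {i}, ⟨?_, ?_⟩, fun t ht => (h ⟨t, ht⟩).elim⟩
      · rw [Finset.card_image_of_injective _ Finset.singleton_injective, Finset.card_range]
      · simp
  choose F hF hFt using hF
  obtain ⟨Q, hQ⟩ := exists_odd_card_inter F (fun e => (hF e).1) (fun e => (hF e).2) s
  refine ⟨Finset.equivBitIndices.symm Q, fun e he t _ ht hmin => ?_⟩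
  obtain ⟨Z, hZ, hodd⟩ := hQ e he
  rw [hFt e t ht hmin, Finset.mem_image] at hZ
  obtain ⟨p, hp, rfl⟩ := hZ
  refine ⟨p, lt_of_mem_bits hp, hp, ?_⟩
  rw [← Nat.odd_iff]
  simpa [bits] using hodd

open Classical in
/-- The code of the least finite set that is good at stage `s`. -/
noncomputable def goodSet (s : ℕ) : ℕ := Nat.find (exists_isGood s)

theorem isGood_goodSet (s : ℕ) : IsGood s (goodSet s) := by
  classical exact Nat.find_spec (exists_isGood s)

theorem computable_goodSet : Computable goodSet := by
  classical
  have h : Partrec fun s => Nat.rfind fun m => Part.some (decide (IsGood s m)) :=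
    Partrec.rfind (p := fun s m => Part.some (decide (IsGood s m)))
      (Computable.partrec primrecRel_isGood.decide.to_comp)
  refine Partrec.of_eq h fun s => Part.eq_some_iff.2 (Nat.mem_rfind.2 ⟨?_, fun {m} hm => ?_⟩)
  · simpa using isGood_goodSet s
  · simpa using Nat.find_min (exists_isGood s) hm

/-- The color of the finite set with code `n`: the parity of its intersection with the good set at
the stage given by its largest element. -/
noncomputable def colorCode (n : ℕ) : Fin 2 :=
  if #(bits (goodSet (topBit n)) ∩ bits n) % 2 = 0 then 0 else 1

theorem computable_colorCode : Computable colorCode := by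
  have h : Computable fun n => #(bits (goodSet (topBit n)) ∩ bits n) :=
    primrec_card_inter_bits.to_comp.comp (computable_goodSet.comp primrec_topBit.to_comp)
      Computable.id
  have h' : Primrec fun k : ℕ => if k % 2 = 0 then (0 : Fin 2) else 1 :=
    Primrec.ite (Primrec.eq.comp (nat_mod.comp Primrec.id (Primrec.const 2)) (Primrec.const 0))
      (Primrec.const 0) (Primrec.const 1)
  exact h'.to_comp.comp h

/-! ### Families that survive forever -/

theorem Survives.anti {e p s s' : ℕ} (hs : s ≤ s') (h : Survives e p s') : Survives e p s :=
  fun y hy h0 => h y (hy.trans_le hs) (Code.evaln_mono hs h0)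

theorem IsFamily.anti {e t s s' : ℕ} (hs : s ≤ s') (h : IsFamily e t s') : IsFamily e t s :=
  ⟨h.1, fun p hp hpt => ⟨(h.2 p hp hpt).1, (h.2 p hp hpt).2.1.anti hs, (h.2 p hp hpt).2.2⟩⟩

/-- Surviving every stage means being a correct witness, for a program that decides `R`. -/
theorem exists_code_forall_survives_iff {R : ℕ → ℕ → Finset ℕ → Prop}
    (hR : ComputablePred fun t : ℕ × ℕ × ℕ => R t.1 t.2.1 (Finset.equivBitIndices t.2.2)) :
    ∃ e : ℕ, ∀ p : ℕ, (∀ s, Survives e p s) ↔ ∀ y, R p.unpair.2 y (bits p.unpair.1) := by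
  classical
  obtain ⟨_, hR⟩ := hR
  obtain ⟨c, hc⟩ := Code.exists_code.1 hR
  have hval (x y z : ℕ) : c.eval (Nat.pair x (Nat.pair y z)) =
      Part.some (if R x y (bits z) then 1 else 0) := by
    rw [hc]
    by_cases h : R x y (bits z) <;> simp [h, -Finset.equivBitIndices_apply]
  refine ⟨Encodable.encode c, fun p => ⟨fun h y => ?_, fun h s y _ h0 => ?_⟩⟩
  · by_contra hy
    have h0 : 0 ∈ c.eval (Nat.pair p.unpair.2 (Nat.pair y p.unpair.1)) := by
      rw [hval, if_neg hy]
      simp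
    obtain ⟨k, hk⟩ := Code.evaln_complete.1 h0
    refine h (max k (y + 1)) y (by omega) ?_
    rw [Denumerable.ofNat_encode]
    exact Code.evaln_mono (le_max_left _ _) hk
  · rw [Denumerable.ofNat_encode] at h0
    have := Code.evaln_sound h0
    rw [hval, if_pos (h y)] at this
    simp at this

theorem exists_isFamily {e : ℕ} {S : Set (Finset ℕ)} (hS : S.Infinite)
    (h : ∀ Z ∈ S, ∃ x, ∀ s, Survives e (Nat.pair (Finset.equivBitIndices.symm Z) x) s) :
    ∃ t, ∀ s, IsFamily e t s := by
  classical
  obtain ⟨F, hFS, hF⟩ := (hS.sdiff (Set.finite_singleton ∅)).exists_subset_card_eq (2 ^ e)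
  choose! x hx using h
  set g : Finset ℕ → ℕ := fun Z => Nat.pair (Finset.equivBitIndices.symm Z) (x Z) with hg
  have hg1 (Z : Finset ℕ) : (g Z).unpair.1 = Finset.equivBitIndices.symm Z := by simp [hg]
  have g_inj : Function.Injective g := fun A B hAB =>
    Finset.equivBitIndices.symm.injective (by rw [← hg1, ← hg1, hAB])
  have hbits : bits (Finset.equivBitIndices.symm (F.image g)) = F.image g :=
    Finset.equivBitIndices.apply_symm_apply _
  refine ⟨Finset.equivBitIndices.symm (F.image g), fun s => ⟨?_, ?_⟩⟩
  · rw [hbits, Finset.card_image_of_injective _ g_inj, hF]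
  · rw [hbits]
    intro p _ hp
    obtain ⟨Z, hZ, rfl⟩ := Finset.mem_image.1 hp
    refine ⟨fun h0 => (hFS hZ).2 ?_, hx Z (hFS hZ).1 s, fun q _ hq hqp => ?_⟩
    · rw [hg1, Equiv.symm_apply_eq] at h0
      simpa using h0
    · obtain ⟨Z', -, rfl⟩ := Finset.mem_image.1 hq
      rw [hg1, hg1] at hqp
      rw [Finset.equivBitIndices.symm.injective hqp]

/-- Survival only decreases with the stage, so the least family at stage `s` is eventually
constant. -/
theorem exists_forall_ge_isFamily {e : ℕ} (h : ∃ t, ∀ s, IsFamily e t s) :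
    ∃ t s₀, (∀ s, IsFamily e t s) ∧ ∀ s ≥ s₀, ∀ t' < t, ¬ IsFamily e t' s := by
  classical
  have hdie : ∀ t' < Nat.find h, ∃ s, ¬ IsFamily e t' s := fun t' ht' =>
    not_forall.1 (Nat.find_min h ht')
  choose! d hd using hdie
  refine ⟨Nat.find h, (Finset.range (Nat.find h)).sup d, Nat.find_spec h, fun s hs t' ht' hf => ?_⟩
  exact hd t' ht' (hf.anti ((Finset.le_sup (Finset.mem_range.2 ht')).trans hs))

theorem exists_mem_forall_lt {D : Set (Finset ℕ)} (hinf : D.Infinite) (hD : D.Pairwise Disjoint)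
    (b : ℕ) : ∃ T ∈ D, T.Nonempty ∧ ∀ i ∈ T, b < i := by
  classical
  -- Two members of `D` have the same trace on `{0, …, b}`; as they are disjoint, it is empty.
  obtain ⟨T, hT, T', hT', hne, htrace⟩ :=
    (hinf.sdiff (Set.finite_singleton ∅)).exists_ne_map_eq_of_mapsTo
      (f := fun T => T ∩ Finset.range (b + 1)) (t := ((Finset.range (b + 1)).powerset : Set _))
      (fun T _ => by simp) (Finset.finite_toSet _)
  refine ⟨T, hT.1, Finset.nonempty_iff_ne_empty.2 hT.2, fun i hi => ?_⟩
  by_contra! hib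
  have : i ∈ T' ∩ Finset.range (b + 1) := by
    rw [← show T ∩ _ = T' ∩ _ from htrace]
    exact Finset.mem_inter.2 ⟨hi, Finset.mem_range.2 (Nat.lt_succ_of_le hib)⟩
  exact Finset.disjoint_left.1 (hD hT.1 hT'.1 hne) hi (Finset.mem_inter.1 this).1

/-- If some family for `e` survives forever, then, for every nonempty `T` far enough out, adding to
`T` a suitable set with a witness that survives forever changes the color: the largest element,
hence the good set, stays the same, while the size of the intersection changes by an odd number. -/
theorem exists_colorCode_union_ne {e : ℕ} (h : ∃ t, ∀ s, IsFamily e t s) :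
    ∃ b, ∀ T : Finset ℕ, T.Nonempty → (∀ i ∈ T, b < i) → ∃ p, (∀ s, Survives e p s) ∧
      colorCode (Finset.equivBitIndices.symm (T ∪ bits p.unpair.1)) ≠
        colorCode (Finset.equivBitIndices.symm T) := by
  obtain ⟨t, s₀, ht, hmin⟩ := exists_forall_ge_isFamily h
  refine ⟨max s₀ (max e t), fun T hT hbT => ?_⟩
  set m := T.max' hT with hm
  have hbm : max s₀ (max e t) < m := hbT _ (T.max'_mem hT)
  obtain ⟨p, hpt, hp, hodd⟩ := isGood_goodSet m e (by omega) t (by omega) (ht m)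
    (hmin m (by omega))
  refine ⟨p, fun s => ((ht s).2 p hpt hp).2.1, ?_⟩
  set Z := bits p.unpair.1 with hZ
  have hZb : ∀ i ∈ Z, i ≤ max s₀ (max e t) := fun i hi => by
    have := lt_of_mem_bits hi
    have := Nat.unpair_left_le p
    omega
  have htop (A : Finset ℕ) (hmA : m ∈ A) (hA : ∀ i ∈ A, i ≤ m) :
      topBit (Finset.equivBitIndices.symm A) = m :=
    topBit_eq (by simpa [bits] using hmA) (by simpa [bits] using hA)
  have hdisj : Disjoint T Z := Finset.disjoint_left.2 fun i hiT hiZ =>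
    (hbT i hiT).not_ge (hZb i hiZ)
  have hTm : ∀ i ∈ T, i ≤ m := fun i hi => T.le_max' i hi
  have hcard : #(bits (goodSet m) ∩ (T ∪ Z)) =
      #(bits (goodSet m) ∩ T) + #(bits (goodSet m) ∩ Z) := by
    rw [Finset.inter_union_distrib_left, Finset.card_union_of_disjoint]
    exact hdisj.mono Finset.inter_subset_right Finset.inter_subset_right
  have hcolor (A : Finset ℕ) (hmA : m ∈ A) (hA : ∀ i ∈ A, i ≤ m) :
      colorCode (Finset.equivBitIndices.symm A) =
        if #(bits (goodSet m) ∩ A) % 2 = 0 then 0 else 1 := by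
    rw [colorCode, htop A hmA hA, bits, bits, Equiv.apply_symm_apply]
  rw [hcolor T (T.max'_mem hT) hTm, hcolor (T ∪ Z) (Finset.mem_union_left _ (T.max'_mem hT)) ?_,
    hcard]
  · split_ifs <;> omega
  · intro i hi
    rcases Finset.mem_union.1 hi with hi | hi
    · exact hTm i hi
    · exact (hZb i hi).trans hbm.le

end FiniteUnions

theorem mainTheorem1 :
    ∃ c : Finset ℕ → Fin 2, FiniteUnions.IsComputableColoring c ∧
      ∀ S : Set (Finset ℕ), FiniteUnions.IsSigmaTwo S → FiniteUnions.GeneratesIP S →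
        ¬ FiniteUnions.IsMonochromatic c (FiniteUnions.NU S) := by
  refine ⟨fun Z => FiniteUnions.colorCode (Finset.equivBitIndices.symm Z), ?_, ?_⟩
  · simpa [FiniteUnions.IsComputableColoring, -Finset.equivBitIndices_apply,
      -Finset.equivBitIndices_symm_apply] using FiniteUnions.computable_colorCode
  · rintro S ⟨R, hR, hS⟩ ⟨D, hDS, hinf, hD⟩ ⟨i, hi⟩
    obtain ⟨e, he⟩ := FiniteUnions.exists_code_forall_survives_iff hR
    have hfam : ∃ t, ∀ s, FiniteUnions.IsFamily e t s := by
      refine FiniteUnions.exists_isFamily (hinf.mono hDS) fun Z hZ => ?_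
      obtain ⟨x, hx⟩ := (hS Z).1 hZ
      refine ⟨x, (he _).2 ?_⟩
      simpa [FiniteUnions.bits, -Finset.equivBitIndices_apply,
        -Finset.equivBitIndices_symm_apply] using hx
    obtain ⟨b, hb⟩ := FiniteUnions.exists_colorCode_union_ne hfam
    obtain ⟨T, hTD, hT, hbT⟩ := FiniteUnions.exists_mem_forall_lt hinf hD b
    obtain ⟨p, hp, hne⟩ := hb T hT hbT
    have hZS : FiniteUnions.bits p.unpair.1 ∈ S := (hS _).2 ⟨_, (he p).1 hp⟩
    refine hne ((hi _ ⟨hT.inl, {T, FiniteUnions.bits p.unpair.1}, ?_, ?_⟩).trans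
      (hi T ⟨hT, {T}, ?_, ?_⟩).symm)
    · simp [hDS hTD, hZS, -Finset.equivBitIndices_apply]
    · simp
    · simp [hDS hTD]
    · simp
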